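/- Let $X$ be a nonempty smooth compact Riemannian manifold without boundary of dimension $d\ge 1$, with Riemannian distance $\operatorname{dist}$ (equal to $+\infty$ between different components, if $X$ is disconnected) and Riemannian volume $dx$ normalized so that $dx(X)=1$. For positive finite Borel measures $\mu,\nu$ on $X$ of equal mass put $$W_1(\mu,\nu)=\inf_{\pi}\int_{X\times X}\operatorname{dist}(x,y)\,d\pi(x,y),$$ the infimum being over all positive measures $\pi$ on $X\times X$ with marginals $\mu$ and $\nu$; for arbitrary positive finite Borel measures $\mu,\nu$ put $$W_1^{1,1}(\mu,\nu)=\inf_{\tilde\mu,\tilde\nu}\;|\mu-\tilde\mu|+|\nu-\tilde\nu|+W_1(\tilde\mu,\tilde\nu),$$ the infimum being over all positive finite Borel measures $\tilde\mu,\tilde\nu$ of equal mass, where $|\sigma|=\sigma_+(X)+\sigma_-(X)$ is the total mass of a signed measure with Jordan decomposition $\sigma=\sigma_+-\sigma_-$; and for signed finite Borel measures $\mu,\nu$ put $$\mathbf W_1^{1,1}(\mu,\nu)=W_1^{1,1}(\mu_++\nu_-,\;\mu_-+\nu_+).$$ Then there is a constant $c>0$, depending only on $X$, such that for every $N\ge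 1$ and all points $z_1,\dots,z_N\in X$ $$W_1\Big(\frac1N\sum_{i=1}^N\delta_{z_i},\,dx\Big)\ \ge\ \frac{c}{N^{1/d}},$$ and, with the same $c$, for all integers $N_1,N_2\ge 0$ with $N_1+N_2\ge 1$ and all points $x_1,\dots,x_{N_1},y_1,\dots,y_{N_2}\in X$ $$\mathbf W_1^{1,1}\Big(\frac{1}{N_1+N_2}\Big[\sum_{i=1}^{N_1}\delta_{x_i}-\sum_{j=1}^{N_2}\delta_{y_j}\Big],\,dx\Big)\ \ge\ \frac{c}{(N_1+N_2)^{1/d}}-\frac{2N_2}{N_1+N_2}.$$ -/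

import Mathlib

open MeasureTheory Manifold Bundle
open scoped ENNReal ContDiff

noncomputable section

namespace SignedTransport

section Volume

variable {d : ℕ} (M : Type*) [EMetricSpace M] [ChartedSpace (EuclideanSpace ℝ (Fin d)) M]
  [IsManifold (𝓡 d) ∞ M] [RiemannianBundle (fun x : M => TangentSpace (𝓡 d) x)]

variable {M} in
/-- The coordinate vector field `∂ᵢ` of the chart at `p`, at the point with coordinates `y`. -/
def coordVector (p : M) (y : EuclideanSpace ℝ (Fin d)) (i : Fin d) :
    TangentSpace (𝓡 d) ((chartAt (EuclideanSpace ℝ (Fin d)) p).symm y) :=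
  mfderiv (𝓡 d) (𝓡 d) (chartAt (EuclideanSpace ℝ (Fin d)) p).symm y
    (EuclideanSpace.single i (1 : ℝ) : EuclideanSpace ℝ (Fin d))

variable {M} in
/-- The metric coefficients `gᵢⱼ = g(∂ᵢ, ∂ⱼ)` in the chart at `p`, at the coordinates `y`. -/
def metricCoeff (p : M) (y : EuclideanSpace ℝ (Fin d)) : Matrix (Fin d) (Fin d) ℝ :=
  Matrix.of fun i j => inner ℝ (coordVector p y i) (coordVector p y j)

variable [MeasurableSpace M]

variable {M} in
/-- The Riemannian volume on the domain of the chart at `p` (and zero off it): the push-forward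
to `M` of `√(det g) dy` on the image of the chart. -/
def chartVolume (p : M) : Measure M :=
  ((volume.restrict (chartAt (EuclideanSpace ℝ (Fin d)) p).target).withDensity
    (fun y => ENNReal.ofReal (Real.sqrt (metricCoeff p y).det))).map
      (chartAt (EuclideanSpace ℝ (Fin d)) p).symm

variable (d) in
/-- The Riemannian volume measure. The chart volumes agree on overlaps of chart domains, and the
volume is the measure that restricts to each of them, which is their least upper bound in the
lattice of measures. -/
def riemannianVolume : Measure M := ⨆ p : M, chartVolume (d := d) p

variable (d) in
/-- The normalized Riemannian volume measure `dx`. -/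
def normalizedVolume : Measure M :=
  (riemannianVolume d M Set.univ)⁻¹ • riemannianVolume d M

instance isFiniteMeasure_normalizedVolume : IsFiniteMeasure (normalizedVolume d M) where
  measure_univ_lt_top := by
    simp only [normalizedVolume, Measure.smul_apply, smul_eq_mul]
    exact lt_of_le_of_lt (ENNReal.inv_mul_le_one _) ENNReal.one_lt_top

end Volume

section Wasserstein

variable {M : Type*} [MeasurableSpace M]

/-- `γ` is a transference plan between `μ` and `ν`. -/
def IsTransferencePlan (γ : Measure (M × M)) (μ ν : Measure M) : Prop :=
  γ.fst = μ ∧ γ.snd = ν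

/-- The `1`-Wasserstein distance, for positive finite measures of the same mass. -/
def W₁ [EMetricSpace M] (μ ν : Measure M) : ℝ≥0∞ :=
  ⨅ (γ : Measure (M × M)) (_ : IsTransferencePlan γ μ ν), ∫⁻ z, edist z.1 z.2 ∂γ

/-- The total mass `|σ| = σ₊(M) + σ₋(M)` of a signed measure. -/
def totalMass (σ : SignedMeasure M) : ℝ≥0∞ := σ.totalVariation Set.univ

/-- The generalized Wasserstein distance `W₁^{1,1}` between positive finite measures. -/
def genW₁ [EMetricSpace M] (μ ν : FiniteMeasure M) : ℝ≥0∞ :=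
  ⨅ (μ' : FiniteMeasure M) (ν' : FiniteMeasure M) (_ : μ'.mass = ν'.mass),
    totalMass ((μ : Measure M).toSignedMeasure - (μ' : Measure M).toSignedMeasure)
      + totalMass ((ν : Measure M).toSignedMeasure - (ν' : Measure M).toSignedMeasure)
      + W₁ (μ' : Measure M) (ν' : Measure M)

/-- The positive part of the Jordan decomposition. -/
def posPart (σ : SignedMeasure M) : FiniteMeasure M :=
  ⟨σ.toJordanDecomposition.posPart, inferInstance⟩

/-- The negative part of the Jordan decomposition. -/
def negPart (σ : SignedMeasure M) : FiniteMeasure M :=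
  ⟨σ.toJordanDecomposition.negPart, inferInstance⟩

/-- The signed generalized Wasserstein distance
`𝐖₁^{1,1}(μ, ν) = W₁^{1,1}(μ₊ + ν₋, μ₋ + ν₊)`. -/
def signedW₁ [EMetricSpace M] (μ ν : SignedMeasure M) : ℝ≥0∞ :=
  genW₁ (posPart μ + negPart ν) (negPart μ + posPart ν)

/-- The empirical measure `(1/N) ∑ δ_{z_i}`. -/
def empirical {N : ℕ} (z : Fin N → M) : Measure M :=
  (N : ℝ≥0∞)⁻¹ • ∑ i, Measure.dirac (z i)

/-- The signed measure `(∑ δ_{x_i} - ∑ δ_{y_j}) / (N₁ + N₂)`. -/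
def signedEmpirical {N₁ N₂ : ℕ} (x : Fin N₁ → M) (y : Fin N₂ → M) : SignedMeasure M :=
  (1 / ((N₁ : ℝ) + (N₂ : ℝ))) •
    (∑ i, (Measure.dirac (x i)).toSignedMeasure - ∑ j, (Measure.dirac (y j)).toSignedMeasure)

end Wasserstein

end SignedTransport

end

/-!
For every set `s` the truncated distance `min (dist · s) r` is `1`-Lipschitz and vanishes on
`s`, so its integral against `μ` bounds from below the transport distance to `μ` from any
measure carried by `s`. When `r ≤ 1` it is also at most `1`, so changing a measure by total
mass `m` changes its integral by at most `m`, and the bound survives for the generalized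
distance; in the signed case only the positive part of the empirical measure enters, and it is
carried by the points `x_i`.

If balls of radius `r` have mass at most `K * r^d`, then for `r` a small multiple of `N^(-1/d)`
the balls of radius `r` around `N` points leave half of the total mass uncovered. On the
uncovered part the truncated distance is `r`, which gives a lower bound of order `N^(-1/d)`.

The Riemannian volume has such a bound near any given point: there a chart is Lipschitz for the
Riemannian distance and the density `√(det g)` is bounded. One point suffices, because the
integral of the test function decreases when the measure is restricted to a neighbourhood.
-/

open scoped NNReal Topology

namespace SignedTransport

section Jordan

variable {M : Type*} [MeasurableSpace M]

theorem le_sub_add_self (μ ν : Measure M) [IsFiniteMeasure μ] [IsFiniteMeasure ν] :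
    μ ≤ μ - ν + ν := by
  have h : μ + (ν - μ) = μ - ν + ν := by
    rw [← Measure.toSignedMeasure_eq_toSignedMeasure_iff, Measure.toSignedMeasure_add,
      Measure.toSignedMeasure_add, ← sub_eq_sub_iff_add_eq_add]
    exact Measure.sub_toSignedMeasure_eq_toSignedMeasure_sub
  exact h ▸ Measure.le_add_right le_rfl

theorem totalMass_toSignedMeasure_sub (μ ν : Measure M) [IsFiniteMeasure μ] [IsFiniteMeasure ν] :
    totalMass (μ.toSignedMeasure - ν.toSignedMeasure) =
      (μ - ν) Set.univ + (ν - μ) Set.univ := by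
  rw [totalMass, SignedMeasure.totalVariation, Measure.toJordanDecomposition_toSignedMeasure_sub]
  rfl

theorem totalMass_toSignedMeasure_sub_comm (μ ν : Measure M) [IsFiniteMeasure μ]
    [IsFiniteMeasure ν] : totalMass (μ.toSignedMeasure - ν.toSignedMeasure) =
      totalMass (ν.toSignedMeasure - μ.toSignedMeasure) := by
  rw [totalMass_toSignedMeasure_sub, totalMass_toSignedMeasure_sub, add_comm]

theorem lintegral_le_lintegral_add_totalMass (μ ν : Measure M) [IsFiniteMeasure μ]
    [IsFiniteMeasure ν] {f : M → ℝ≥0∞} (hf : ∀ x, f x ≤ 1) :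
    ∫⁻ x, f x ∂μ ≤ ∫⁻ x, f x ∂ν + totalMass (μ.toSignedMeasure - ν.toSignedMeasure) :=
  calc ∫⁻ x, f x ∂μ ≤ ∫⁻ x, f x ∂(μ - ν + ν) := lintegral_mono' (le_sub_add_self μ ν) le_rfl
    _ = ∫⁻ x, f x ∂ν + ∫⁻ x, f x ∂(μ - ν) := by rw [lintegral_add_measure, add_comm]
    _ ≤ ∫⁻ x, f x ∂ν + (μ - ν) Set.univ := by
      gcongr
      exact (lintegral_mono hf).trans_eq lintegral_one
    _ ≤ ∫⁻ x, f x ∂ν + totalMass (μ.toSignedMeasure - ν.toSignedMeasure) := by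
      rw [totalMass_toSignedMeasure_sub]
      gcongr
      exact le_self_add

theorem posPart_toSignedMeasure_sub_le (μ ν : Measure M) [IsFiniteMeasure μ] [IsFiniteMeasure ν] :
    (posPart (μ.toSignedMeasure - ν.toSignedMeasure) : Measure M) ≤ μ := by
  change (μ.toSignedMeasure - ν.toSignedMeasure).toJordanDecomposition.posPart ≤ μ
  rw [Measure.toJordanDecomposition_toSignedMeasure_sub]
  exact Measure.sub_le

theorem toJordanDecomposition_toSignedMeasure (μ : Measure M) [IsFiniteMeasure μ] :
    μ.toSignedMeasure.toJordanDecomposition =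
      ⟨μ, 0, Measure.MutuallySingular.zero_right⟩ :=
  SignedMeasure.toJordanDecomposition_eq (by simp [JordanDecomposition.toSignedMeasure])

theorem posPart_toSignedMeasure (μ : Measure M) [IsFiniteMeasure μ] :
    (posPart μ.toSignedMeasure : Measure M) = μ :=
  congrArg JordanDecomposition.posPart (toJordanDecomposition_toSignedMeasure μ)

theorem negPart_toSignedMeasure (μ : Measure M) [IsFiniteMeasure μ] :
    negPart μ.toSignedMeasure = 0 :=
  Subtype.ext (congrArg JordanDecomposition.negPart (toJordanDecomposition_toSignedMeasure μ))

theorem toSignedMeasure_finsetSum {ι : Type*} (s : Finset ι) (μ : ι → Measure M)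
    [∀ i, IsFiniteMeasure (μ i)] :
    (∑ i ∈ s, μ i).toSignedMeasure = ∑ i ∈ s, (μ i).toSignedMeasure := by
  classical
  induction s using Finset.induction_on with
  | empty => simp
  | insert i s hi ih => simp [Finset.sum_insert hi, Measure.toSignedMeasure_add, ih]

end Jordan

section EmpiricalMeasures

variable {M : Type*} [MeasurableSpace M] [MeasurableSingletonClass M]

theorem sum_dirac_compl_range {ι : Type*} [Fintype ι] (z : ι → M) :
    (∑ i, Measure.dirac (z i)) (Set.range z)ᶜ = 0 := by
  simp [Measure.dirac_apply' _ (Set.finite_range z).measurableSet.compl]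

theorem empirical_compl_range {N : ℕ} (z : Fin N → M) : empirical z (Set.range z)ᶜ = 0 := by
  rw [empirical, Measure.smul_apply, sum_dirac_compl_range, smul_zero]

theorem posPart_signedEmpirical_compl_range {N₁ N₂ : ℕ} (x : Fin N₁ → M) (y : Fin N₂ → M) :
    (posPart (signedEmpirical x y) : Measure M) (Set.range x)ᶜ = 0 := by
  let a : ℝ≥0 := 1 / (N₁ + N₂)
  have h : signedEmpirical x y = (a • ∑ i, Measure.dirac (x i)).toSignedMeasure -
      (a • ∑ j, Measure.dirac (y j)).toSignedMeasure := by
    rw [Measure.toSignedMeasure_smul, Measure.toSignedMeasure_smul, toSignedMeasure_finsetSum,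
      toSignedMeasure_finsetSum]
    exact smul_sub (1 / ((N₁ : ℝ) + (N₂ : ℝ))) _ _
  rw [h, ← nonpos_iff_eq_zero]
  refine (posPart_toSignedMeasure_sub_le _ _ _).trans ?_
  rw [Measure.smul_apply, sum_dirac_compl_range, smul_zero]

end EmpiricalMeasures

section Duality

variable {M : Type*} [EMetricSpace M] [MeasurableSpace M] {f : M → ℝ≥0∞}

theorem lintegral_le_lintegral_add_W₁ {μ ν : Measure M} (hf : Measurable f)
    (hlip : ∀ x y, f y ≤ f x + edist x y) : ∫⁻ x, f x ∂ν ≤ ∫⁻ x, f x ∂μ + W₁ μ ν := by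
  rw [← tsub_le_iff_left]
  refine le_iInf₂ fun γ hγ => tsub_le_iff_left.2 ?_
  obtain ⟨rfl, rfl⟩ := hγ
  calc ∫⁻ y, f y ∂γ.snd = ∫⁻ z, f z.2 ∂γ := lintegral_map hf measurable_snd
    _ ≤ ∫⁻ z, (f z.1 + edist z.1 z.2) ∂γ := lintegral_mono fun z => hlip z.1 z.2
    _ = ∫⁻ z, f z.1 ∂γ + ∫⁻ z, edist z.1 z.2 ∂γ := lintegral_add_left (hf.comp measurable_fst) _
    _ = ∫⁻ x, f x ∂γ.fst + ∫⁻ z, edist z.1 z.2 ∂γ := by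
      rw [Measure.fst, lintegral_map hf measurable_fst]

theorem lintegral_le_lintegral_add_genW₁ (μ ν : FiniteMeasure M) (hf : Measurable f)
    (hlip : ∀ x y, f y ≤ f x + edist x y) (hf1 : ∀ x, f x ≤ 1) :
    ∫⁻ x, f x ∂(ν : Measure M) ≤ ∫⁻ x, f x ∂(μ : Measure M) + genW₁ μ ν := by
  rw [← tsub_le_iff_left]
  refine le_iInf₂ fun μ' ν' => le_iInf fun _ => tsub_le_iff_left.2 ?_
  have hμ := lintegral_le_lintegral_add_totalMass (μ' : Measure M) (μ : Measure M) hf1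
  have hW := lintegral_le_lintegral_add_W₁ (μ := (μ' : Measure M)) (ν := (ν' : Measure M)) hf hlip
  have hν := lintegral_le_lintegral_add_totalMass (ν : Measure M) (ν' : Measure M) hf1
  rw [totalMass_toSignedMeasure_sub_comm] at hμ
  refine (hν.trans (add_le_add_left (hW.trans (add_le_add_left hμ _)) _)).trans_eq ?_
  ring

end Duality

section TruncatedDistance

variable {M : Type*} [PseudoEMetricSpace M]

/-- The distance to the set `s` truncated at height `r`; the `1`-Lipschitz test function of the
lower bounds for transport distances. -/
noncomputable def truncInfEDist (s : Set M) (r : ℝ≥0∞) (x : M) : ℝ≥0∞ :=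
  min (Metric.infEDist x s) r

theorem truncInfEDist_le_add_edist (s : Set M) (r : ℝ≥0∞) (x y : M) :
    truncInfEDist s r y ≤ truncInfEDist s r x + edist x y := by
  rw [truncInfEDist, truncInfEDist, min_add, edist_comm]
  exact min_le_min Metric.infEDist_le_infEDist_add_edist le_self_add

theorem truncInfEDist_of_mem {s : Set M} {x : M} (hx : x ∈ s) (r : ℝ≥0∞) :
    truncInfEDist s r x = 0 := by
  rw [truncInfEDist, Metric.infEDist_zero_of_mem hx, zero_min]

variable [MeasurableSpace M]

theorem measurable_truncInfEDist [OpensMeasurableSpace M] (s : Set M) (r : ℝ≥0∞) :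
    Measurable (truncInfEDist s r) :=
  measurable_infEDist.min measurable_const

theorem lintegral_truncInfEDist_eq_zero {s : Set M} {μ : Measure M} (h : μ sᶜ = 0) (r : ℝ≥0∞) :
    ∫⁻ x, truncInfEDist s r x ∂μ = 0 :=
  lintegral_eq_zero_of_ae_eq_zero <|
    Filter.mem_of_superset (mem_ae_iff.2 h) fun _ hx => truncInfEDist_of_mem hx r

end TruncatedDistance

section TransportLowerBounds

variable {M : Type*} [EMetricSpace M] [MeasurableSpace M] [OpensMeasurableSpace M]

theorem lintegral_truncInfEDist_le_W₁ {s : Set M} {μ : Measure M} (hμ : μ sᶜ = 0) (ν : Measure M)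
    (r : ℝ≥0∞) : ∫⁻ x, truncInfEDist s r x ∂ν ≤ W₁ μ ν := by
  simpa only [lintegral_truncInfEDist_eq_zero hμ, zero_add] using
    lintegral_le_lintegral_add_W₁ (μ := μ) (ν := ν) (measurable_truncInfEDist s r)
      (truncInfEDist_le_add_edist s r)

theorem lintegral_truncInfEDist_le_signedW₁ {s : Set M} {σ : SignedMeasure M}
    (hσ : (posPart σ : Measure M) sᶜ = 0) (ν : Measure M) [IsFiniteMeasure ν] {r : ℝ≥0∞}
    (hr : r ≤ 1) : ∫⁻ x, truncInfEDist s r x ∂ν ≤ signedW₁ σ ν.toSignedMeasure := by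
  have hν : ν ≤ (negPart σ + posPart ν.toSignedMeasure : FiniteMeasure M) := by
    rw [FiniteMeasure.toMeasure_add, posPart_toSignedMeasure]
    exact Measure.le_add_left le_rfl
  have hgen := lintegral_le_lintegral_add_genW₁ (posPart σ)
    (negPart σ + posPart ν.toSignedMeasure) (measurable_truncInfEDist s r)
    (truncInfEDist_le_add_edist s r) fun _ => (min_le_right _ _).trans hr
  rw [lintegral_truncInfEDist_eq_zero hσ, zero_add] at hgen
  rw [signedW₁, negPart_toSignedMeasure, add_zero]
  exact (lintegral_mono' hν le_rfl).trans hgen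

end TransportLowerBounds

section UpperRegularity

variable {M : Type*} [PseudoEMetricSpace M] [MeasurableSpace M]

/-- Upper Ahlfors regularity of dimension `t`: balls of radius `r` have measure at most
`K * r ^ t`. -/
def IsUpperRegular (K : ℝ≥0) (t : ℝ) (ν : Measure M) : Prop :=
  ∀ (x : M) (r : ℝ≥0), ν (Metric.eball x r) ≤ K * (r : ℝ≥0∞) ^ t

theorem IsUpperRegular.smul {K : ℝ≥0} {t : ℝ} {ν : Measure M} (hν : IsUpperRegular K t ν)
    (a : ℝ≥0) : IsUpperRegular (a * K) t (a • ν) := fun x r => by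
  rw [Measure.smul_apply, ENNReal.smul_def, smul_eq_mul, ENNReal.coe_mul, mul_assoc]
  exact mul_le_mul_right (hν x r) _

variable [OpensMeasurableSpace M]

theorem mul_le_lintegral_truncInfEDist {ι : Type*} [Fintype ι] (z : ι → M) {ν : Measure M}
    {r ε : ℝ≥0∞} (hε : ∀ i, ν (Metric.eball (z i) r) ≤ ε) :
    r * (ν Set.univ - Fintype.card ι * ε) ≤ ∫⁻ x, truncInfEDist (Set.range z) r x ∂ν := by
  set A : Set M := ⋃ i, Metric.eball (z i) r
  have hA : MeasurableSet A := .iUnion fun i => Metric.isOpen_eball.measurableSet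
  have hνA : ν A ≤ Fintype.card ι * ε := by
    refine (measure_iUnion_fintype_le ν _).trans ((Finset.sum_le_sum fun i _ => hε i).trans ?_)
    simp
  have hfar : ∀ x ∈ Aᶜ, r ≤ truncInfEDist (Set.range z) r x := fun x hx => by
    refine le_min (Metric.le_infEDist.2 ?_) le_rfl
    rintro _ ⟨i, rfl⟩
    exact not_lt.1 fun hlt => hx (Set.mem_iUnion.2 ⟨i, hlt⟩)
  calc r * (ν Set.univ - Fintype.card ι * ε) ≤ r * ν Aᶜ := by
        gcongr
        rw [tsub_le_iff_left, ← measure_add_measure_compl hA]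
        gcongr
    _ = ∫⁻ _ in Aᶜ, r ∂ν := (setLIntegral_const _ _).symm
    _ ≤ ∫⁻ x in Aᶜ, truncInfEDist (Set.range z) r x ∂ν := setLIntegral_mono' hA.compl hfar
    _ ≤ ∫⁻ x, truncInfEDist (Set.range z) r x ∂ν := setLIntegral_le_lintegral _ _

theorem IsUpperRegular.mul_half_le_lintegral_truncInfEDist {K : ℝ≥0} {t : ℝ} {ν : Measure M}
    [IsFiniteMeasure ν] (hν : IsUpperRegular K t ν) {ι : Type*} [Fintype ι] (z : ι → M) {r : ℝ≥0}
    (hr : Fintype.card ι * (K * (r : ℝ≥0∞) ^ t) ≤ ν Set.univ / 2) :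
    r * (ν Set.univ / 2) ≤ ∫⁻ x, truncInfEDist (Set.range z) r x ∂ν :=
  calc r * (ν Set.univ / 2) = r * (ν Set.univ - ν Set.univ / 2) := by
        rw [ENNReal.sub_half (measure_ne_top ν _)]
    _ ≤ r * (ν Set.univ - Fintype.card ι * (K * (r : ℝ≥0∞) ^ t)) := by gcongr
    _ ≤ ∫⁻ x, truncInfEDist (Set.range z) r x ∂ν :=
        mul_le_lintegral_truncInfEDist z fun i => hν (z i) r

theorem IsUpperRegular.exists_lintegral_truncInfEDist_ge {K : ℝ≥0} {t : ℝ} (ht : 0 < t)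
    {ν : Measure M} [IsFiniteMeasure ν] [NeZero ν] (hν : IsUpperRegular K t ν) :
    ∃ c : ℝ, 0 < c ∧ ∀ N : ℕ, 0 < N → ∀ n ≤ N, ∀ z : Fin n → M, ∃ r : ℝ≥0∞, r ≤ 1 ∧
      ENNReal.ofReal (c / (N : ℝ) ^ (1 / t)) ≤ ∫⁻ x, truncInfEDist (Set.range z) r x ∂ν := by
  obtain ⟨m, hm⟩ : ∃ m : ℝ≥0, (m : ℝ≥0∞) = ν Set.univ / 2 :=
    ⟨_, ENNReal.coe_toNNReal (ENNReal.div_ne_top (measure_ne_top ν _) two_ne_zero)⟩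
  have hm0 : 0 < m := by
    rw [← ENNReal.coe_pos, hm]
    exact ENNReal.half_pos (NeZero.ne _)
  -- The cutoff `1` keeps the radius `(b / N) ^ (1 / t)` at most `1`, as the test functions require.
  let b : ℝ≥0 := min 1 (m / (K + 1))
  have hKb : K * b ≤ m :=
    calc K * b ≤ (K + 1) * (m / (K + 1)) := by gcongr; exacts [le_self_add, min_le_right _ _]
      _ = m := by field_simp
  refine ⟨b ^ (1 / t) * m, by positivity, fun N hN n hn z => ?_⟩
  let r : ℝ≥0 := (b / N) ^ (1 / t)
  have hrt : r ^ t = b / N := by rw [← NNReal.rpow_mul, one_div_mul_cancel ht.ne', NNReal.rpow_one]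
  have hr1 : r ≤ 1 := by
    refine NNReal.rpow_le_one (div_le_one_of_le₀ ?_ zero_le) (by positivity)
    exact (min_le_left _ _).trans (by exact_mod_cast hN)
  have hcover : (n : ℝ≥0) * (K * r ^ t) ≤ m :=
    calc (n : ℝ≥0) * (K * r ^ t) ≤ N * (K * (b / N)) := by rw [hrt]; gcongr
      _ = K * b := by field_simp
      _ ≤ m := hKb
  have hrm : (b : ℝ) ^ (1 / t) * m / (N : ℝ) ^ (1 / t) = (r * m : ℝ≥0) := by
    push_cast [r]
    rw [Real.div_rpow b.coe_nonneg N.cast_nonneg, div_mul_eq_mul_div]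
  refine ⟨r, by exact_mod_cast hr1, ?_⟩
  rw [hrm, ENNReal.ofReal_coe_nnreal, ENNReal.coe_mul, hm]
  refine hν.mul_half_le_lintegral_truncInfEDist z ?_
  rw [← hm, Fintype.card_fin, ← ENNReal.coe_rpow_of_nonneg _ ht.le]
  exact_mod_cast hcover

end UpperRegularity

section Quantization

variable {M : Type*} [EMetricSpace M] [MeasurableSpace M] [OpensMeasurableSpace M]

theorem IsUpperRegular.exists_transport_lower_bound {K : ℝ≥0} {t : ℝ} (ht : 0 < t)
    {ν μ : Measure M} [IsFiniteMeasure μ] [NeZero ν] (hν : IsUpperRegular K t ν)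
    (hνμ : ν ≤ μ) :
    ∃ c : ℝ, 0 < c ∧
      (∀ N : ℕ, 0 < N → ∀ z : Fin N → M,
        ENNReal.ofReal (c / (N : ℝ) ^ (1 / t)) ≤ W₁ (empirical z) μ) ∧
      (∀ N N₁ N₂ : ℕ, 0 < N → N₁ ≤ N → ∀ (x : Fin N₁ → M) (y : Fin N₂ → M),
        ENNReal.ofReal (c / (N : ℝ) ^ (1 / t)) ≤
          signedW₁ (signedEmpirical x y) μ.toSignedMeasure) := by
  have : IsFiniteMeasure ν := isFiniteMeasure_of_le μ hνμ
  obtain ⟨c, hc, hquant⟩ := hν.exists_lintegral_truncInfEDist_ge ht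
  refine ⟨c, hc, fun N hN z => ?_, fun N N₁ N₂ hN hN₁ x y => ?_⟩
  · obtain ⟨r, -, hr⟩ := hquant N hN N le_rfl z
    exact hr.trans <| (lintegral_mono' hνμ le_rfl).trans <|
      lintegral_truncInfEDist_le_W₁ (empirical_compl_range z) μ r
  · obtain ⟨r, hr1, hr⟩ := hquant N hN N₁ hN₁ x
    exact hr.trans <| (lintegral_mono' hνμ le_rfl).trans <|
      lintegral_truncInfEDist_le_signedW₁ (posPart_signedEmpirical_compl_range x y) μ hr1

end Quantization

section GramDeterminant

variable {ι V : Type*} [Fintype ι] [SeminormedAddCommGroup V] [InnerProductSpace ℝ V]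

theorem gram_sum_smul (v : ι → V) (A : Matrix ι ι ℝ) :
    Matrix.gram ℝ (fun j => ∑ i, A i j • v i) = A.transpose * Matrix.gram ℝ v * A := by
  ext i j
  simp only [Matrix.gram_apply, sum_inner, inner_sum, inner_smul_left, inner_smul_right,
    conj_trivial, Matrix.mul_apply, Matrix.transpose_apply, Finset.sum_mul, Finset.mul_sum]
  exact Finset.sum_congr rfl fun k _ => Finset.sum_congr rfl fun l _ => by ring

variable [DecidableEq ι]

theorem exists_orthonormalBasis_det_gram_eq_prod (v : ι → V) :
    ∃ b : OrthonormalBasis ι ℝ (EuclideanSpace ℝ ι),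
      (Matrix.gram ℝ v).det = ∏ i, ‖∑ j, b i j • v j‖ ^ 2 := by
  have hG := Matrix.isHermitian_gram ℝ v
  refine ⟨hG.eigenvectorBasis, hG.det_eq_prod_eigenvalues.trans ?_⟩
  refine Finset.prod_congr rfl fun i _ => ?_
  rw [hG.eigenvalues_eq, Matrix.star_dotProduct_gram_mulVec, real_inner_self_eq_norm_sq]
  rfl

theorem det_gram_le {v : ι → V} {C : ℝ}
    (hC : ∀ c : EuclideanSpace ℝ ι, ‖∑ i, c i • v i‖ ≤ C * ‖c‖) :
    (Matrix.gram ℝ v).det ≤ (C ^ 2) ^ Fintype.card ι := by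
  obtain ⟨b, hb⟩ := exists_orthonormalBasis_det_gram_eq_prod v
  rw [hb, ← Finset.card_univ, ← Finset.prod_const]
  refine Finset.prod_le_prod (fun i _ => by positivity) fun i _ => ?_
  gcongr
  simpa using hC (b i)

theorem le_det_gram {v : ι → V} {C : ℝ} (hC0 : 0 ≤ C)
    (hC : ∀ c : EuclideanSpace ℝ ι, C * ‖c‖ ≤ ‖∑ i, c i • v i‖) :
    (C ^ 2) ^ Fintype.card ι ≤ (Matrix.gram ℝ v).det := by
  obtain ⟨b, hb⟩ := exists_orthonormalBasis_det_gram_eq_prod v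
  rw [hb, ← Finset.card_univ, ← Finset.prod_const]
  refine Finset.prod_le_prod (fun i _ => by positivity) fun i _ => ?_
  gcongr
  simpa using hC (b i)

theorem det_gram_sum_smul (v : ι → V) (A : Matrix ι ι ℝ) :
    (Matrix.gram ℝ fun j => ∑ i, A i j • v i).det = A.det ^ 2 * (Matrix.gram ℝ v).det := by
  rw [gram_sum_smul, Matrix.det_mul, Matrix.det_mul, Matrix.det_transpose]
  ring

end GramDeterminant

section RiemannianDistance

attribute [local instance] normedAddCommGroupTangentSpaceVectorSpace
  normedSpaceTangentSpaceVectorSpace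

variable {E : Type*} [NormedAddCommGroup E] [NormedSpace ℝ E] {H : Type*} [TopologicalSpace H]
  {I : ModelWithCorners ℝ E H} {F : Type*} [NormedAddCommGroup F] [NormedSpace ℝ F]

section Paths

variable {M : Type*} [TopologicalSpace M] [ChartedSpace H M]
  [RiemannianBundle (fun x : M => TangentSpace I x)]

theorem edist_le_mul_pathELength {f : M → F} {γ : ℝ → M} {C : ℝ≥0}
    (hγ : ContMDiffOn 𝓘(ℝ, ℝ) I 1 γ (Set.Icc 0 1))
    (hf : ∀ t ∈ Set.Icc (0 : ℝ) 1, ContMDiffAt I 𝓘(ℝ, F) 1 f (γ t))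
    (hC : ∀ t ∈ Set.Icc (0 : ℝ) 1, ∀ v : TangentSpace I (γ t),
      ‖mfderiv I 𝓘(ℝ, F) f (γ t) v‖ₑ ≤ C * ‖v‖ₑ) :
    edist (f (γ 0)) (f (γ 1)) ≤ C * pathELength I γ 0 1 := by
  have hfγ : ContDiffOn ℝ 1 (f ∘ γ) (Set.Icc 0 1) :=
    contMDiffOn_iff_contDiffOn.1 fun t ht => (hf t ht).comp_contMDiffWithinAt t (hγ t ht)
  have hderiv : ∀ t ∈ Set.Icc (0 : ℝ) 1, derivWithin (f ∘ γ) (Set.Icc 0 1) t =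
      mfderiv I 𝓘(ℝ, F) f (γ t) (mfderivWithin 𝓘(ℝ, ℝ) I γ (Set.Icc 0 1) t (1 : ℝ)) := by
    intro t ht
    have hunique := (uniqueDiffOn_Icc (zero_lt_one' ℝ) t ht).uniqueMDiffWithinAt
    rw [← fderivWithin_derivWithin, ← mfderivWithin_eq_fderivWithin,
      mfderiv_comp_mfderivWithin t ((hf t ht).mdifferentiableAt one_ne_zero)
        ((hγ t ht).mdifferentiableWithinAt one_ne_zero) hunique]
    rfl
  calc edist (f (γ 0)) (f (γ 1)) = ‖(f ∘ γ) 1 - (f ∘ γ) 0‖ₑ := by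
        rw [edist_comm, edist_eq_enorm_sub]
        rfl
    _ ≤ ∫⁻ t in Set.Icc (0 : ℝ) 1, ‖derivWithin (f ∘ γ) (Set.Icc 0 1) t‖ₑ :=
        enorm_sub_le_lintegral_derivWithin_Icc_of_contDiffOn_Icc hfγ zero_le_one
    _ ≤ ∫⁻ t in Set.Icc (0 : ℝ) 1,
          C * ‖mfderivWithin 𝓘(ℝ, ℝ) I γ (Set.Icc 0 1) t (1 : ℝ)‖ₑ := by
        refine setLIntegral_mono' measurableSet_Icc fun t ht => ?_
        rw [hderiv t ht]
        exact hC t ht _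
    _ = C * pathELength I γ 0 1 := by
        rw [lintegral_const_mul' _ _ ENNReal.coe_ne_top, pathELength_eq_lintegral_mfderivWithin_Icc]
        rfl

end Paths

variable {M : Type*} [PseudoEMetricSpace M] [ChartedSpace H M]
  [RiemannianBundle (fun x : M => TangentSpace I x)] [IsRiemannianManifold I M]

theorem edist_le_pathELength {γ : ℝ → M} {a b : ℝ} (hγ : ContMDiffOn 𝓘(ℝ, ℝ) I 1 γ (Set.Icc a b))
    (hab : a ≤ b) : edist (γ a) (γ b) ≤ pathELength I γ a b := by
  rw [IsRiemannianManifold.out (I := I)]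
  exact riemannianEDist_le_pathELength hγ rfl rfl hab

theorem lipschitzOnWith_eball_of_enorm_mfderiv_le {f : M → F} {x₀ : M} {r : ℝ≥0∞} {C : ℝ≥0}
    (hf : ∀ x ∈ Metric.eball x₀ (3 * r), ContMDiffAt I 𝓘(ℝ, F) 1 f x)
    (hC : ∀ x ∈ Metric.eball x₀ (3 * r), ∀ v : TangentSpace I x,
      ‖mfderiv I 𝓘(ℝ, F) f x v‖ₑ ≤ C * ‖v‖ₑ) :
    LipschitzOnWith C f (Metric.eball x₀ r) := by
  intro x hx y hy
  have hxy : edist x y < 2 * r :=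
    calc edist x y ≤ edist x x₀ + edist y x₀ := edist_triangle_right _ _ _
      _ < 2 * r := two_mul r ▸ ENNReal.add_lt_add hx hy
  -- A path from `x` to `y` of length less than `2 * r` stays in the ball of radius `3 * r`.
  have hshort : ∀ L ∈ Set.Ioo (edist x y) (2 * r), edist (f x) (f y) ≤ C * L := by
    rintro L ⟨hL, hLr⟩
    rw [IsRiemannianManifold.out (I := I) x y] at hL
    obtain ⟨γ, rfl, rfl, hγ, hγL⟩ := exists_lt_of_riemannianEDist_lt hL
    have hmem : ∀ t ∈ Set.Icc (0 : ℝ) 1, γ t ∈ Metric.eball x₀ (3 * r) := fun t ht =>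
      calc edist (γ t) x₀ ≤ edist (γ 0) (γ t) + edist (γ 0) x₀ := edist_triangle_left _ _ _
        _ ≤ pathELength I γ 0 1 + edist (γ 0) x₀ := by
          gcongr
          exact (edist_le_pathELength (hγ.mono (Set.Icc_subset_Icc_right ht.2)) ht.1).trans
            (pathELength_mono le_rfl ht.2)
        _ < 2 * r + r := ENNReal.add_lt_add (hγL.trans hLr) hx
        _ = 3 * r := by ring
    calc edist (f (γ 0)) (f (γ 1)) ≤ C * pathELength I γ 0 1 :=
          edist_le_mul_pathELength hγ (fun t ht => hf _ (hmem t ht)) fun t ht => hC _ (hmem t ht)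
      _ ≤ C * L := by gcongr
  have : (𝓝[>] edist x y).NeBot := nhdsGT_neBot_of_exists_gt ⟨_, hxy⟩
  refine ge_of_tendsto (f := fun L => (C : ℝ≥0∞) * L) (x := 𝓝[>] edist x y) ?_
    (Filter.eventually_of_mem (Ioo_mem_nhdsGT hxy) hshort)
  exact (ENNReal.Tendsto.const_mul Filter.tendsto_id (.inr ENNReal.coe_ne_top)).mono_left
    nhdsWithin_le_nhds

theorem exists_lipschitzOnWith_extChartAt [IsManifold I 1 M]
    [IsContinuousRiemannianBundle E (fun x : M => TangentSpace I x)] (x₀ : M) :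
    ∃ C, ∃ U ∈ 𝓝 x₀, LipschitzOnWith C (extChartAt I x₀) U := by
  obtain ⟨C, -, hC⟩ := eventually_enorm_mfderiv_extChartAt_lt I x₀
  obtain ⟨δ, hδ, hball⟩ := EMetric.mem_nhds_iff.1 (hC.and (chart_source_mem_nhds H x₀))
  have hδ3 : 3 * (δ / 3) = δ := ENNReal.mul_div_cancel three_ne_zero (by simp)
  refine ⟨C, Metric.eball x₀ (δ / 3), Metric.eball_mem_nhds x₀ (ENNReal.div_pos hδ.ne' (by simp)),
    lipschitzOnWith_eball_of_enorm_mfderiv_le (I := I) ?_ ?_⟩ <;> rw [hδ3]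
  · exact fun x hx => contMDiffAt_extChartAt' (hball hx).2
  · exact fun x hx v => (ContinuousLinearMap.le_opENorm _ v).trans
      (mul_le_mul_left (hball hx).1.le _)

end RiemannianDistance

section ChartDerivative

attribute [local instance] normedAddCommGroupTangentSpaceVectorSpace
  normedSpaceTangentSpaceVectorSpace

variable {E : Type*} [NormedAddCommGroup E] [NormedSpace ℝ E] {M : Type*} [TopologicalSpace M]
  [ChartedSpace E M] [IsManifold 𝓘(ℝ, E) 1 M]

theorem differentiableAt_chartAt_comp_chartAt_symm {p q : M} {y : E}
    (hy : y ∈ (chartAt E p).target) (hyq : (chartAt E p).symm y ∈ (chartAt E q).source) :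
    DifferentiableAt ℝ (chartAt E q ∘ (chartAt E p).symm) y := by
  rw [← mdifferentiableAt_iff_differentiableAt]
  exact ((mdifferentiable_chart (I := 𝓘(ℝ, E)) q).mdifferentiableAt hyq).comp y
    ((mdifferentiable_chart (I := 𝓘(ℝ, E)) p).mdifferentiableAt_symm hy)

theorem mfderiv_chartAt_symm_eq_comp {p q : M} {y : E} (hy : y ∈ (chartAt E p).target)
    (hyq : (chartAt E p).symm y ∈ (chartAt E q).source) (v : E) :
    mfderiv 𝓘(ℝ, E) 𝓘(ℝ, E) (chartAt E p).symm y v =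
      mfderiv 𝓘(ℝ, E) 𝓘(ℝ, E) (chartAt E q).symm (chartAt E q ((chartAt E p).symm y))
        (fderiv ℝ (chartAt E q ∘ (chartAt E p).symm) y v) := by
  have hsymm : (chartAt E p).symm =ᶠ[𝓝 y]
      (chartAt E q).symm ∘ (chartAt E q ∘ (chartAt E p).symm) := by
    filter_upwards [((chartAt E p).isOpen_inter_preimage_symm
      (chartAt E q).open_source).mem_nhds ⟨hy, hyq⟩] with z hz
    exact ((chartAt E q).left_inv hz.2).symm
  rw [← mfderiv_eq_fderiv]
  exact DFunLike.congr_fun (hsymm.mfderiv_eq.trans <| mfderiv_comp y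
    ((mdifferentiable_chart q).mdifferentiableAt_symm ((chartAt E q).map_source hyq))
    (differentiableAt_chartAt_comp_chartAt_symm hy hyq).mdifferentiableAt) v

variable [RiemannianBundle (fun x : M => TangentSpace 𝓘(ℝ, E) x)]
  [IsContinuousRiemannianBundle E (fun x : M => TangentSpace 𝓘(ℝ, E) x)]

theorem exists_eventually_enorm_mfderiv_chartAt_symm_le (x₀ : M) :
    ∃ C : ℝ≥0, ∀ᶠ y in 𝓝 (chartAt E x₀ x₀), ∀ v : E,
      ‖mfderiv 𝓘(ℝ, E) 𝓘(ℝ, E) (chartAt E x₀).symm y v‖ₑ ≤ C * ‖v‖ₑ := by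
  obtain ⟨C, -, hC⟩ := eventually_enorm_mfderivWithin_symm_extChartAt_lt 𝓘(ℝ, E) x₀
  simp only [modelWithCornersSelf_coe, Set.range_id, nhdsWithin_univ, mfderivWithin_univ] at hC
  exact ⟨C, hC.mono fun y hy v =>
    (ContinuousLinearMap.le_opENorm (mfderiv 𝓘(ℝ, E) 𝓘(ℝ, E) (extChartAt 𝓘(ℝ, E) x₀).symm y)
      v).trans (mul_le_mul_left hy.le _)⟩

theorem exists_eventually_enorm_le_mfderiv_chartAt_symm (x₀ : M) :
    ∃ C : ℝ≥0, ∀ᶠ y in 𝓝 (chartAt E x₀ x₀), ∀ v : E,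
      ‖v‖ₑ ≤ C * ‖mfderiv 𝓘(ℝ, E) 𝓘(ℝ, E) (chartAt E x₀).symm y v‖ₑ := by
  obtain ⟨C, -, hC⟩ := eventually_enorm_mfderiv_extChartAt_lt 𝓘(ℝ, E) x₀
  let P := chartAt E x₀
  have hx₀ : x₀ ∈ P.source := mem_chart_source E x₀
  have hsymm : Filter.Tendsto P.symm (𝓝 (P x₀)) (𝓝 x₀) := P.tendsto_symm hx₀
  refine ⟨C, ?_⟩
  filter_upwards [hsymm.eventually hC, P.open_target.mem_nhds (P.map_source hx₀)] with y hy hyt v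
  let w : TangentSpace 𝓘(ℝ, E) (P.symm y) := mfderiv 𝓘(ℝ, E) 𝓘(ℝ, E) P.symm y v
  have hv : mfderiv 𝓘(ℝ, E) 𝓘(ℝ, E) P (P.symm y) w = v :=
    DFunLike.congr_fun ((mdifferentiable_chart (I := 𝓘(ℝ, E)) x₀).comp_symm_deriv hyt) v
  calc ‖v‖ₑ = ‖mfderiv 𝓘(ℝ, E) 𝓘(ℝ, E) P (P.symm y) w‖ₑ := by rw [hv]; rfl
    _ ≤ C * ‖w‖ₑ := (ContinuousLinearMap.le_opENorm
          (mfderiv 𝓘(ℝ, E) 𝓘(ℝ, E) (extChartAt 𝓘(ℝ, E) x₀) (P.symm y)) w).trans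
            (mul_le_mul_left hy.le _)

end ChartDerivative

theorem volume_le_ediam_pow {ι : Type*} [Fintype ι] (s : Set (EuclideanSpace ℝ ι)) :
    volume s ≤ Metric.ediam s ^ Fintype.card ι := by
  have himage : WithLp.ofLp '' s = MeasurableEquiv.toLp 2 (ι → ℝ) ⁻¹' s :=
    (WithLp.equiv 2 (ι → ℝ)).image_eq_preimage_symm s
  calc volume s = volume (WithLp.ofLp '' s) := by
        rw [himage]
        exact ((PiLp.volume_preserving_toLp ι).measure_preimage_equiv s).symm
    _ ≤ Metric.ediam (WithLp.ofLp '' s) ^ Fintype.card ι := Real.volume_pi_le_diam_pow _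
    _ ≤ Metric.ediam s ^ Fintype.card ι := by
        gcongr
        simpa using (PiLp.lipschitzWith_ofLp 2 fun _ : ι => ℝ).ediam_image_le s

theorem measurableSet_inter_preimage {X Y : Type*} [TopologicalSpace X] [MeasurableSpace X]
    [OpensMeasurableSpace X] [TopologicalSpace Y] [MeasurableSpace Y] [BorelSpace Y] {f : X → Y}
    {s : Set X} {A : Set Y} (hf : ContinuousOn f s) (hs : MeasurableSet s) (hA : MeasurableSet A) :
    MeasurableSet (s ∩ f ⁻¹' A) := by
  rw [← Subtype.image_preimage_coe]
  exact hs.subtype_image (hf.domRestrict.measurable hA)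

theorem restrict_iSup_le {α ι : Type*} [MeasurableSpace α] {μ : ι → Measure α} {ν : Measure α}
    {s : Set α} (hs : MeasurableSet s) (h : ∀ i, (μ i).restrict s ≤ ν) :
    (⨆ i, μ i).restrict s ≤ ν := by
  have hsup : ⨆ i, μ i ≤ ν + (⨆ i, μ i).restrict sᶜ := iSup_le fun i => by
    rw [← Measure.restrict_add_restrict_compl (μ := μ i) hs]
    exact add_le_add (h i) (Measure.restrict_mono le_rfl (le_iSup μ i))
  calc (⨆ i, μ i).restrict s ≤ (ν + (⨆ i, μ i).restrict sᶜ).restrict s :=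
        Measure.restrict_mono le_rfl hsup
    _ = ν.restrict s := by
        rw [Measure.restrict_add, Measure.restrict_restrict hs, Set.inter_compl_self,
          Measure.restrict_empty, add_zero]
    _ ≤ ν := Measure.restrict_le_self

section RiemannianVolume

variable {d : ℕ} {M : Type*} [EMetricSpace M] [ChartedSpace (EuclideanSpace ℝ (Fin d)) M]

local notation "ℝᵈ" => EuclideanSpace ℝ (Fin d)

theorem sum_smul_coordVector (p : M) (y v : ℝᵈ) :
    ∑ i, v i • coordVector p y i = mfderiv (𝓡 d) (𝓡 d) (chartAt ℝᵈ p).symm y v := by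
  let L : ℝᵈ →ₗ[ℝ] TangentSpace (𝓡 d) ((chartAt ℝᵈ p).symm y) :=
    (mfderiv (𝓡 d) (𝓡 d) (chartAt ℝᵈ p).symm y).toLinearMap
  calc ∑ i, v i • L (EuclideanSpace.single i 1) = L (∑ i, v i • EuclideanSpace.single i 1) := by
        simp only [map_sum, map_smul]
    _ = L v := by simpa using congrArg L ((EuclideanSpace.basisFun (Fin d) ℝ).sum_repr v)

variable [RiemannianBundle (fun x : M => TangentSpace (𝓡 d) x)]

theorem metricCoeff_eq_gram (p : M) (y : ℝᵈ) : metricCoeff p y = Matrix.gram ℝ (coordVector p y) :=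
  rfl

section Density

variable [IsManifold (𝓡 d) 1 M] [IsContinuousRiemannianBundle (EuclideanSpace ℝ (Fin d))
  (fun x : M => TangentSpace (𝓡 d) x)]

theorem exists_eventually_sqrt_det_metricCoeff_le (p : M) :
    ∃ D : ℝ≥0, ∀ᶠ y in 𝓝 (chartAt ℝᵈ p p), √(metricCoeff p y).det ≤ D := by
  obtain ⟨C, hC⟩ := exists_eventually_enorm_mfderiv_chartAt_symm_le (E := ℝᵈ) p
  refine ⟨C ^ d, hC.mono fun y hy => ?_⟩
  have hdet : (metricCoeff p y).det ≤ ((C : ℝ) ^ 2) ^ Fintype.card (Fin d) := by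
    refine det_gram_le (v := coordVector p y) fun v => ?_
    have hv := hy v
    rw [← sum_smul_coordVector] at hv
    simp only [enorm_eq_nnnorm] at hv
    exact_mod_cast hv
  refine Real.sqrt_le_iff.2 ⟨by positivity, hdet.trans_eq ?_⟩
  rw [Fintype.card_fin, NNReal.coe_pow, pow_right_comm]

theorem exists_eventually_le_sqrt_det_metricCoeff (p : M) :
    ∃ D : ℝ≥0, 0 < D ∧ ∀ᶠ y in 𝓝 (chartAt ℝᵈ p p), D ≤ √(metricCoeff p y).det := by
  obtain ⟨C, hC⟩ := exists_eventually_enorm_le_mfderiv_chartAt_symm (E := ℝᵈ) p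
  refine ⟨(C + 1)⁻¹ ^ d, by positivity, hC.mono fun y hy => ?_⟩
  have hdet : (((C + 1 : ℝ≥0) : ℝ)⁻¹ ^ 2) ^ Fintype.card (Fin d) ≤ (metricCoeff p y).det := by
    refine le_det_gram (v := coordVector p y) (by positivity) fun v => ?_
    have hv : ‖v‖ₑ ≤ (C + 1 : ℝ≥0) * ‖∑ i, v i • coordVector p y i‖ₑ := by
      rw [sum_smul_coordVector]
      exact (hy v).trans (by gcongr; exact le_self_add)
    rw [inv_mul_le_iff₀ (by positivity)]
    simp only [enorm_eq_nnnorm] at hv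
    exact_mod_cast hv
  refine Real.le_sqrt_of_sq_le (le_trans (Eq.le ?_) hdet)
  rw [Fintype.card_fin, NNReal.coe_pow, NNReal.coe_inv, pow_right_comm]

end Density

-- All tangent spaces are the type `ℝᵈ`, but their inner products depend on the base point.
theorem gram_tangentSpace_congr {ι : Type*} {a b : M} (h : a = b) (v : ι → ℝᵈ) :
    Matrix.gram ℝ (E := TangentSpace (𝓡 d) a) v = Matrix.gram ℝ (E := TangentSpace (𝓡 d) b) v := by
  subst h
  rfl

theorem det_metricCoeff_transition [IsManifold (𝓡 d) 1 M] {p q : M} {y : ℝᵈ}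
    (hy : y ∈ (chartAt ℝᵈ p).target) (hyq : (chartAt ℝᵈ p).symm y ∈ (chartAt ℝᵈ q).source) :
    (metricCoeff p y).det = (fderiv ℝ (chartAt ℝᵈ q ∘ (chartAt ℝᵈ p).symm) y).det ^ 2 *
      (metricCoeff q (chartAt ℝᵈ q ((chartAt ℝᵈ p).symm y))).det := by
  let J := fderiv ℝ (chartAt ℝᵈ q ∘ (chartAt ℝᵈ p).symm) y
  let w := chartAt ℝᵈ q ((chartAt ℝᵈ p).symm y)
  let b := (EuclideanSpace.basisFun (Fin d) ℝ).toBasis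
  let A := LinearMap.toMatrix b b J
  have hcoord : coordVector p y = fun j => ∑ i, A i j • coordVector q w i := by
    ext1 j
    have hJ : J (EuclideanSpace.single j 1) = WithLp.toLp 2 fun i => A i j := by
      ext i
      simp [A, b, LinearMap.toMatrix_apply]
    rw [coordVector, mfderiv_chartAt_symm_eq_comp hy hyq]
    exact (congrArg (mfderiv (𝓡 d) (𝓡 d) (chartAt ℝᵈ q).symm w) hJ).trans
      (sum_smul_coordVector q w _).symm
  calc (metricCoeff p y).det = (Matrix.gram ℝ fun j => ∑ i, A i j • coordVector q w i).det := by
        rw [metricCoeff_eq_gram, hcoord]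
        exact congrArg Matrix.det (gram_tangentSpace_congr ((chartAt ℝᵈ q).left_inv hyq).symm _)
    _ = A.det ^ 2 * (metricCoeff q w).det := det_gram_sum_smul _ _
    _ = J.det ^ 2 * (metricCoeff q w).det := by rw [LinearMap.det_toMatrix]

variable [MeasurableSpace M] [BorelSpace M]

theorem chartVolume_apply (p : M) {A : Set M} (hA : MeasurableSet A) :
    chartVolume (d := d) p A = ∫⁻ y in (chartAt ℝᵈ p).target ∩ (chartAt ℝᵈ p).symm ⁻¹' A,
      ENNReal.ofReal √(metricCoeff p y).det := by
  have hP : AEMeasurable (chartAt ℝᵈ p).symm (volume.restrict (chartAt ℝᵈ p).target) :=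
    (chartAt ℝᵈ p).continuousOn_symm.aemeasurable (chartAt ℝᵈ p).open_target.measurableSet
  rw [chartVolume, Measure.map_apply_of_aemeasurable
    (hP.mono_ac (withDensity_absolutelyContinuous _ _)) hA, withDensity_apply',
    Measure.restrict_restrict' (chartAt ℝᵈ p).open_target.measurableSet, Set.inter_comm]

theorem chartVolume_apply_of_subset {p : M} {A : Set M} (hA : MeasurableSet A)
    (hAp : A ⊆ (chartAt ℝᵈ p).source) :
    chartVolume (d := d) p A =
      ∫⁻ y in chartAt ℝᵈ p '' A, ENNReal.ofReal √(metricCoeff p y).det := by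
  rw [chartVolume_apply p hA, ← (chartAt ℝᵈ p).image_eq_target_inter_inv_preimage hAp]

theorem chartVolume_restrict_source (p : M) :
    (chartVolume (d := d) p).restrict (chartAt ℝᵈ p).source = chartVolume (d := d) p := by
  have hcompl : (chartAt ℝᵈ p).target ∩ (chartAt ℝᵈ p).symm ⁻¹' (chartAt ℝᵈ p).sourceᶜ = ∅ :=
    Set.eq_empty_of_forall_notMem fun y hy => hy.2 ((chartAt ℝᵈ p).map_target hy.1)
  have hzero : chartVolume (d := d) p (chartAt ℝᵈ p).sourceᶜ = 0 := by
    rw [chartVolume_apply p (chartAt ℝᵈ p).open_source.measurableSet.compl, hcompl,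
      Measure.restrict_empty, lintegral_zero_measure]
  exact Measure.restrict_eq_self_of_ae_mem (mem_ae_iff.2 hzero)

section Overlaps

variable [IsManifold (𝓡 d) 1 M]

theorem chartVolume_apply_eq_of_subset {p q : M} {A : Set M} (hA : MeasurableSet A)
    (hp : A ⊆ (chartAt ℝᵈ p).source) (hq : A ⊆ (chartAt ℝᵈ q).source) :
    chartVolume (d := d) p A = chartVolume (d := d) q A := by
  let P := chartAt ℝᵈ p
  let Q := chartAt ℝᵈ q
  have hPA : MeasurableSet (P '' A) := by
    rw [P.image_eq_target_inter_inv_preimage hp]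
    exact measurableSet_inter_preimage P.continuousOn_symm P.open_target.measurableSet hA
  have himage : Q '' A = (Q ∘ P.symm) '' (P '' A) := by
    rw [Set.image_comp]
    exact congrArg (Q '' ·) (P.toPartialEquiv.symm_image_image_of_subset_source hp).symm
  have hdomain : ∀ y ∈ P '' A, y ∈ P.target ∧ P.symm y ∈ Q.source := by
    rintro _ ⟨x, hx, rfl⟩
    exact ⟨P.map_source (hp hx), (P.left_inv (hp hx)).symm ▸ hq hx⟩
  have hinj : Set.InjOn (Q ∘ P.symm) (P '' A) :=
    Q.injOn.comp (P.symm.injOn.mono fun y hy => (hdomain y hy).1) fun y hy => (hdomain y hy).2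
  rw [chartVolume_apply_of_subset hA hp, chartVolume_apply_of_subset hA hq, himage,
    lintegral_image_eq_lintegral_abs_det_fderiv_mul volume hPA (fun y hy =>
      (differentiableAt_chartAt_comp_chartAt_symm (hdomain y hy).1
        (hdomain y hy).2).hasFDerivAt.hasFDerivWithinAt) hinj]
  refine setLIntegral_congr_fun hPA fun y hy => ?_
  rw [det_metricCoeff_transition (hdomain y hy).1 (hdomain y hy).2, Real.sqrt_mul (sq_nonneg _),
    Real.sqrt_sq_eq_abs, ENNReal.ofReal_mul (abs_nonneg _)]
  rfl

theorem chartVolume_restrict_source_le (p q : M) :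
    (chartVolume (d := d) p).restrict (chartAt ℝᵈ q).source ≤ chartVolume (d := d) q := by
  have hp := (chartAt ℝᵈ p).open_source.measurableSet
  have hq := (chartAt ℝᵈ q).open_source.measurableSet
  refine Measure.le_iff.2 fun A hA => ?_
  rw [← chartVolume_restrict_source p, Measure.restrict_restrict hq, Measure.restrict_apply hA,
    chartVolume_apply_eq_of_subset (hA.inter (hq.inter hp)) (fun x hx => hx.2.2) fun x hx => hx.2.1]
  exact measure_mono Set.inter_subset_left

theorem riemannianVolume_restrict_source (p : M) :
    (riemannianVolume d M).restrict (chartAt ℝᵈ p).source = chartVolume (d := d) p := by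
  refine le_antisymm (restrict_iSup_le (chartAt ℝᵈ p).open_source.measurableSet
    fun q => chartVolume_restrict_source_le q p) ?_
  rw [← chartVolume_restrict_source p]
  exact Measure.restrict_mono le_rfl (le_iSup (fun q : M => chartVolume (d := d) q) p)

theorem riemannianVolume_apply {p : M} {A : Set M} (hA : MeasurableSet A)
    (hAp : A ⊆ (chartAt ℝᵈ p).source) :
    riemannianVolume d M A =
      ∫⁻ y in chartAt ℝᵈ p '' A, ENNReal.ofReal √(metricCoeff p y).det := by
  rw [← Measure.restrict_eq_self _ hAp, riemannianVolume_restrict_source,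
    chartVolume_apply_of_subset hA hAp]

end Overlaps

variable [IsManifold (𝓡 d) 1 M] [IsContinuousRiemannianBundle (EuclideanSpace ℝ (Fin d))
  (fun x : M => TangentSpace (𝓡 d) x)]

instance isOpenPosMeasure_riemannianVolume : (riemannianVolume d M).IsOpenPosMeasure := by
  refine ⟨fun U hU ⟨x₀, hx₀⟩ => ne_of_gt ?_⟩
  obtain ⟨D, hD0, hD⟩ := exists_eventually_le_sqrt_det_metricCoeff (d := d) x₀
  let P := chartAt ℝᵈ x₀
  have hxP : x₀ ∈ P.source := mem_chart_source ℝᵈ x₀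
  obtain ⟨V, hV, hVo, hxV⟩ := mem_nhds_iff.1 (Filter.inter_mem ((P.continuousAt hxP).eventually hD)
    (Filter.inter_mem (P.open_source.mem_nhds hxP) (hU.mem_nhds hx₀)))
  have hVP : V ⊆ P.source := fun x hx => (hV hx).2.1
  have hPV : IsOpen (P '' V) := P.isOpen_image_of_subset_source hVo hVP
  calc 0 < D * volume (P '' V) :=
        ENNReal.mul_pos (by simpa using hD0.ne') (hPV.measure_pos _ ⟨_, x₀, hxV, rfl⟩).ne'
    _ = ∫⁻ _ in P '' V, D := (setLIntegral_const _ _).symm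
    _ ≤ ∫⁻ y in P '' V, ENNReal.ofReal √(metricCoeff x₀ y).det := by
        refine setLIntegral_mono' hPV.measurableSet ?_
        rintro _ ⟨x, hx, rfl⟩
        exact ENNReal.ofReal_coe_nnreal.symm.trans_le (ENNReal.ofReal_le_ofReal (hV hx).1)
    _ = riemannianVolume d M V := (riemannianVolume_apply hVo.measurableSet hVP).symm
    _ ≤ riemannianVolume d M U := measure_mono fun x hx => (hV hx).2.2

variable [IsRiemannianManifold (𝓡 d) M]

theorem exists_isOpen_riemannianVolume_le_ediam_pow (x₀ : M) :
    ∃ (K : ℝ≥0) (U : Set M), IsOpen U ∧ x₀ ∈ U ∧ ∀ A ⊆ U, MeasurableSet A →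
      riemannianVolume d M A ≤ K * Metric.ediam A ^ d := by
  obtain ⟨D, hD⟩ := exists_eventually_sqrt_det_metricCoeff_le (d := d) x₀
  obtain ⟨C, V, hV, hC⟩ := exists_lipschitzOnWith_extChartAt (I := 𝓡 d) x₀
  let P := chartAt ℝᵈ x₀
  have hxP : x₀ ∈ P.source := mem_chart_source ℝᵈ x₀
  obtain ⟨U, hU, hUo, hxU⟩ := mem_nhds_iff.1 (Filter.inter_mem ((P.continuousAt hxP).eventually hD)
    (Filter.inter_mem (P.open_source.mem_nhds hxP) hV))
  refine ⟨D * C ^ d, U, hUo, hxU, fun A hAU hA => ?_⟩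
  have hAP : A ⊆ P.source := fun x hx => (hU (hAU hx)).2.1
  have hPA : Metric.ediam (P '' A) ≤ C * Metric.ediam A :=
    Metric.ediam_image_le_iff.2 fun x hx y hy =>
      (hC (hU (hAU hx)).2.2 (hU (hAU hy)).2.2).trans
        (mul_le_mul_right (Metric.edist_le_ediam_of_mem hx hy) _)
  calc riemannianVolume d M A = ∫⁻ y in P '' A, ENNReal.ofReal √(metricCoeff x₀ y).det :=
        riemannianVolume_apply hA hAP
    _ ≤ ∫⁻ _ in P '' A, D := by
        refine setLIntegral_mono measurable_const ?_
        rintro _ ⟨x, hx, rfl⟩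
        exact (ENNReal.ofReal_le_ofReal (hU (hAU hx)).1).trans_eq ENNReal.ofReal_coe_nnreal
    _ = D * volume (P '' A) := setLIntegral_const _ _
    _ ≤ D * (C * Metric.ediam A) ^ d := by
        gcongr
        refine (volume_le_ediam_pow _).trans ?_
        rw [Fintype.card_fin]
        gcongr
    _ = (D * C ^ d : ℝ≥0) * Metric.ediam A ^ d := by push_cast; ring

theorem exists_isUpperRegular_restrict_riemannianVolume (x₀ : M) :
    ∃ (K : ℝ≥0) (U : Set M), IsOpen U ∧ x₀ ∈ U ∧
      IsUpperRegular K d ((riemannianVolume d M).restrict U) := by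
  obtain ⟨K, U, hU, hxU, hK⟩ := exists_isOpen_riemannianVolume_le_ediam_pow (d := d) x₀
  refine ⟨K * 2 ^ d, U, hU, hxU, fun x r => ?_⟩
  calc (riemannianVolume d M).restrict U (Metric.eball x r)
      = riemannianVolume d M (Metric.eball x r ∩ U) :=
        Measure.restrict_apply Metric.isOpen_eball.measurableSet
    _ ≤ K * Metric.ediam (Metric.eball x r ∩ U) ^ d :=
        hK _ Set.inter_subset_right (Metric.isOpen_eball.inter hU).measurableSet
    _ ≤ K * (2 * r) ^ d := by
        gcongr
        exact (Metric.ediam_mono Set.inter_subset_left).trans Metric.ediam_eball_le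
    _ = (K * 2 ^ d : ℝ≥0) * (r : ℝ≥0∞) ^ (d : ℝ) := by
        rw [ENNReal.rpow_natCast]
        push_cast
        ring

instance isLocallyFiniteMeasure_riemannianVolume :
    IsLocallyFiniteMeasure (riemannianVolume d M) := by
  refine ⟨fun x₀ => ?_⟩
  obtain ⟨K, U, hU, hxU, hK⟩ := exists_isUpperRegular_restrict_riemannianVolume (d := d) x₀
  refine ⟨Metric.eball x₀ (1 : ℝ≥0) ∩ U, Filter.inter_mem
    (Metric.eball_mem_nhds x₀ (by simp)) (hU.mem_nhds hxU), ?_⟩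
  rw [← Measure.restrict_apply Metric.isOpen_eball.measurableSet]
  exact (hK x₀ 1).trans_lt (by simp)

theorem exists_isUpperRegular_restrict_normalizedVolume [IsFiniteMeasure (riemannianVolume d M)]
    [Nonempty M] : ∃ (K : ℝ≥0) (U : Set M), NeZero ((normalizedVolume d M).restrict U) ∧
      IsUpperRegular K d ((normalizedVolume d M).restrict U) := by
  obtain ⟨x₀⟩ := ‹Nonempty M›
  obtain ⟨K, U, hU, hxU, hK⟩ := exists_isUpperRegular_restrict_riemannianVolume (d := d) x₀
  obtain ⟨a, ha⟩ : ∃ a : ℝ≥0, (a : ℝ≥0∞) = (riemannianVolume d M Set.univ)⁻¹ :=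
    ⟨_, ENNReal.coe_toNNReal (ENNReal.inv_ne_top.2 (isOpen_univ.measure_pos _ ⟨x₀, trivial⟩).ne')⟩
  have hrestrict : (normalizedVolume d M).restrict U = a • (riemannianVolume d M).restrict U := by
    rw [normalizedVolume, Measure.restrict_smul, ← ha]
    rfl
  have ha0 : a ≠ 0 := by
    rw [← ENNReal.coe_ne_zero, ha]
    exact ENNReal.inv_ne_zero.2 (measure_ne_top _ _)
  refine ⟨a * K, U, ⟨fun hzero => ?_⟩, hrestrict ▸ hK.smul a⟩
  rw [hrestrict, smul_eq_zero_iff_right ha0, Measure.restrict_eq_zero] at hzero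
  exact (hU.measure_pos _ ⟨x₀, hxU⟩).ne' hzero

end RiemannianVolume

theorem isContinuousRiemannianBundle_of_isContMDiffRiemannianBundle {EB : Type*}
    [NormedAddCommGroup EB] [NormedSpace ℝ EB] {HB : Type*} [TopologicalSpace HB]
    (IB : ModelWithCorners ℝ EB HB) (n : WithTop ℕ∞) {B : Type*} [TopologicalSpace B]
    [ChartedSpace HB B] (F : Type*) [NormedAddCommGroup F] [NormedSpace ℝ F] (E : B → Type*)
    [TopologicalSpace (TotalSpace F E)] [∀ x, NormedAddCommGroup (E x)]
    [∀ x, InnerProductSpace ℝ (E x)] [FiberBundle F E] [VectorBundle ℝ F E]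
    [IsContMDiffRiemannianBundle IB n F E] : IsContinuousRiemannianBundle F E := by
  obtain ⟨g, hg, hinner⟩ := IsContMDiffRiemannianBundle.exists_contMDiff (IB := IB) (n := n)
    (F := F) (E := E)
  exact ⟨g, hg.continuous, hinner⟩

end SignedTransport

theorem mainTheorem5_general {d : ℕ} (hd : 1 ≤ d) {M : Type*} [EMetricSpace M] [Nonempty M]
    [ChartedSpace (EuclideanSpace ℝ (Fin d)) M] [IsManifold (𝓡 d) 1 M]
    [RiemannianBundle (fun x : M => TangentSpace (𝓡 d) x)]
    [IsContinuousRiemannianBundle (EuclideanSpace ℝ (Fin d))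
      (fun x : M => TangentSpace (𝓡 d) x)]
    [IsRiemannianManifold (𝓡 d) M] [MeasurableSpace M] [BorelSpace M]
    [IsFiniteMeasure (SignedTransport.riemannianVolume d M)] :
    ∃ c : ℝ, 0 < c ∧
      (∀ (N : ℕ), 0 < N → ∀ z : Fin N → M,
        ENNReal.ofReal (c / (N : ℝ) ^ (1 / (d : ℝ))) ≤
          SignedTransport.W₁ (SignedTransport.empirical z)
            (SignedTransport.normalizedVolume d M)) ∧
      (∀ (N N₁ N₂ : ℕ), 0 < N → N₁ ≤ N → ∀ (x : Fin N₁ → M) (y : Fin N₂ → M),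
        ENNReal.ofReal (c / (N : ℝ) ^ (1 / (d : ℝ))) ≤
          SignedTransport.signedW₁ (SignedTransport.signedEmpirical x y)
            (SignedTransport.normalizedVolume d M).toSignedMeasure) := by
  obtain ⟨K, U, _, hK⟩ :=
    SignedTransport.exists_isUpperRegular_restrict_normalizedVolume (d := d) (M := M)
  exact hK.exists_transport_lower_bound (Nat.cast_pos.2 hd) Measure.restrict_le_self

theorem mainTheorem5 {d : ℕ} (hd : 1 ≤ d) {M : Type*} [EMetricSpace M] [CompactSpace M]
    [Nonempty M] [ChartedSpace (EuclideanSpace ℝ (Fin d)) M] [IsManifold (𝓡 d) ∞ M]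
    [RiemannianBundle (fun x : M => TangentSpace (𝓡 d) x)]
    [IsContMDiffRiemannianBundle (𝓡 d) ∞ (EuclideanSpace ℝ (Fin d))
      (fun x : M => TangentSpace (𝓡 d) x)]
    [IsRiemannianManifold (𝓡 d) M] [MeasurableSpace M] [BorelSpace M] :
    ∃ c : ℝ, 0 < c ∧
      (∀ (N : ℕ), 0 < N → ∀ z : Fin N → M,
        ENNReal.ofReal (c / (N : ℝ) ^ (1 / (d : ℝ))) ≤
          SignedTransport.W₁ (SignedTransport.empirical z)
            (SignedTransport.normalizedVolume d M)) ∧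
      (∀ (N₁ N₂ : ℕ), 0 < N₁ + N₂ → ∀ (x : Fin N₁ → M) (y : Fin N₂ → M),
        ENNReal.ofReal (c / ((N₁ : ℝ) + (N₂ : ℝ)) ^ (1 / (d : ℝ))
            - 2 * (N₂ : ℝ) / ((N₁ : ℝ) + (N₂ : ℝ))) ≤
          SignedTransport.signedW₁ (SignedTransport.signedEmpirical x y)
            (SignedTransport.normalizedVolume d M).toSignedMeasure) := by
  have : IsManifold (𝓡 d) 1 M := inferInstance
  have : IsContinuousRiemannianBundle (EuclideanSpace ℝ (Fin d))
      (fun x : M => TangentSpace (𝓡 d) x) :=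
    SignedTransport.isContinuousRiemannianBundle_of_isContMDiffRiemannianBundle (𝓡 d) ∞ _ _
  obtain ⟨c, hc, hempirical, hsigned⟩ := mainTheorem5_general hd (M := M)
  refine ⟨c, hc, hempirical, fun N₁ N₂ hN x y => ?_⟩
  have h := hsigned (N₁ + N₂) N₁ N₂ hN (Nat.le_add_right _ _) x y
  rw [Nat.cast_add] at h
  exact (ENNReal.ofReal_le_ofReal (sub_le_self _ (by positivity))).trans h
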